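/- Let $f$ be an entire function of order $1$, that is, $\limsup_{r\to\infty}\frac{\log\log M(r)}{\log r}=1$ where $M(r)=\max_{|z|=r}|f(z)|$. Suppose that $f$ is real on the real axis and has only real zeros. List the zeros of $f$ as $(z_n)_{n\in I}$, with $I$ a set of consecutive integers (finite, infinite in one direction, or all of $\mathbb Z$), $z_n\le z_{n+1}$, and each zero repeated according to its multiplicity. Let $\inf(z_{n+1}-z_n)$ and $\sup(z_{n+1}-z_n)$, taken over all $n$ with $n,n+1\in I$, be understood in $[0,\infty]$. Let $a\in\mathbb R$ and let $q<p$ be consecutive real zeros of $f'+af$. Then $$\inf (z_{n+1}-z_n)\le p-q,$$ and, if the zeros of $f$ extend to infinity in both directions (that is, $I=\mathbb Z$), also $$p-q\le \sup (z_{n+1}-z_n).$$ Suppose moreover that the zeros of $f$ are simple. If $p-q=\inf(z_{n+1}-z_n)$, or if $I=\mathbb Z$ and $p-q=\sup(z_{n+1}-z_n)$, then both equalities hold, and $f(z)=Ae^{Bz}\cos(Cz+D)$ for some real $A,B,C,D$. -/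

import Mathlib

/-- The maximum modulus `M(r) = max_{|z| = r} |f(z)|`. -/
noncomputable def maxModulus (f : ℂ → ℂ) (r : ℝ) : ℝ :=
  sSup ((fun z : ℂ => ‖f z‖) '' Metric.sphere (0 : ℂ) r)

/-- The order `limsup_{r → ∞} log log M(r) / log r` of an entire function, as an extended real
number. (For a nonconstant entire function `M(r) → ∞`, so that for all large `r` the two iterated
logarithms are those of numbers greater than `1` and `0`; constants get order `0`.) -/
noncomputable def entireOrder (f : ℂ → ℂ) : EReal :=
  Filter.limsup
    (fun r : ℝ => ((Real.log (Real.log (maxModulus f r)) / Real.log r : ℝ) : EReal)) Filter.atTop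

/-- `(z n)`, with `n` running over the set `I` of consecutive integers, lists the real zeros of `f`
in nondecreasing order, each zero repeated according to its multiplicity. The set `I` may be finite,
infinite in one direction, or all of `ℤ`. Values of `z` outside `I` are irrelevant. -/
structure IsZeroList (f : ℂ → ℂ) (I : Set ℤ) (z : ℤ → ℝ) : Prop where
  ordConnected : I.OrdConnected
  monotoneOn : MonotoneOn z I
  multiplicity : ∀ c : ℝ, {n | n ∈ I ∧ z n = c}.encard = analyticOrderAt f (c : ℂ)

/-- The set of gaps `z (n + 1) - z n`, over all `n` such that `n` and `n + 1` are both indices,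
regarded as extended reals so that its infimum and supremum always exist. -/
def zeroGaps (I : Set ℤ) (z : ℤ → ℝ) : Set EReal :=
  {d | ∃ n : ℤ, n ∈ I ∧ n + 1 ∈ I ∧ d = ((z (n + 1) - z n : ℝ) : EReal)}

/-- `q < p` are consecutive real zeros of `g`. -/
def AreConsecutiveZeros (g : ℂ → ℂ) (q p : ℝ) : Prop :=
  q < p ∧ g (q : ℂ) = 0 ∧ g (p : ℂ) = 0 ∧ ∀ x : ℝ, q < x → x < p → g (x : ℂ) ≠ 0

/-- All zeros of `f` are simple. -/
def HasSimpleZeros (f : ℂ → ℂ) : Prop :=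
  ∀ w : ℂ, f w = 0 → deriv f w ≠ 0

/-- `f(w) = A e^{B w} cos (C w + D)` for some real constants `A, B, C, D`. -/
def IsExpCosine (f : ℂ → ℂ) : Prop :=
  ∃ A B C D : ℝ, ∀ w : ℂ, f w = A * Complex.exp (B * w) * Complex.cos (C * w + D)

/-!
Let `u n = 1 / (p - z n)` and `v n = 1 / (q - z n)`. Suppose first that neither `q` nor `p` is a
zero of `f`. Then `f' / f` takes the value `-a` at both points, and the partial fraction expansion
of `f' / f` (`tendsto_sum_sub_logDeriv`) says that the sums of `u n - v n` over `|z n| ≤ R` tend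
to `0` as `R → ∞`. If no zero lies between `q` and `p`, then the individual terms are negative, or
`f` has no zeros and `f' / f` is constant; both are impossible. So there is a zero `z k` in
`(q, p)`, and by Rolle's theorem it is the only one (`exists_isolatesIndex`).

The sums are now rearranged by pairing `u (n + 1)` with `v n`. Since `z n` and `z (n + 1)` lie on
the same side of `q` and `p` respectively, the sign of `u (n + 1) - v n` is that of
`(z (n + 1) - z n) - (p - q)`. If no gap is shorter than `p - q`, all the paired terms and the two
boundary terms are nonnegative. If no gap is longer and the zeros extend to infinity in both
directions, the paired terms are nonpositive and the boundary terms tend to `0`. As the limit is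
`0`, in both cases every gap equals `p - q`, and the list has neither a first nor a last point
(`IsolatesIndex.eq_univ_and_gap_eq_of_le` and `IsolatesIndex.gap_eq_of_ge`). This gives both
inequalities and reduces equality to zeros in arithmetic progression. Then a sine function with the
same zeros has the same partial fractions, so its logarithmic derivative differs from that of `f` by
a constant (`isExpCosine_of_gap_eq`).

If `q` or `p` is a zero of `f`, it is a multiple one. The infimum of the gaps is then `0`, and the
upper bound is Rolle's theorem.

The expansion is obtained without Hadamard's factorization. The function `f` is divided by the
linear factors of its zeros in `[-R, R]`; the quotient has no zeros in a disk of radius `R`, where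
its logarithm is `O(R ^ (3 / 2))` by the growth of `f` and the Borel–Carathéodory inequality. So the
second derivative of that logarithm is `O(R ^ (-1 / 2))` on compact sets (`norm_logDeriv_sub_le`).
-/

open Filter Topology Metric

/-! ### Logarithmic derivatives of zero-free functions on a disk -/

/-- On a disk of radius `R` where `F` has no zeros and `log |F / F(c)| ≤ A`, the logarithmic
derivative oscillates by at most `64 A / R²` times the distance. The Borel–Carathéodory inequality
bounds a branch `H` of `log (F / F(c))` on half the disk, and two Cauchy estimates bound
`H'' = (F' / F)'` on an eighth of it. -/
theorem norm_logDeriv_sub_le {F : ℂ → ℂ} {c : ℂ} {R A : ℝ} (hR : 0 < R) (hA : 0 < A)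
    (hF : DifferentiableOn ℂ F (ball c R)) (hF0 : ∀ w ∈ ball c R, F w ≠ 0)
    (hbound : ∀ w ∈ ball c R, ‖F w‖ ≤ Real.exp A * ‖F c‖) {z w : ℂ}
    (hz : z ∈ ball c (R / 8)) (hw : w ∈ ball c (R / 8)) :
    ‖logDeriv F z - logDeriv F w‖ ≤ 64 * A / R ^ 2 * ‖z - w‖ := by
  have hc : c ∈ ball c R := mem_ball_self hR
  have hL : DifferentiableOn ℂ (logDeriv F) (ball c R) :=
    (hF.deriv isOpen_ball).div hF hF0
  obtain ⟨H, hHc, hH⟩ : ∃ H : ℂ → ℂ, H c = 0 ∧ ∀ u ∈ ball c R, HasDerivAt H (logDeriv F u) u := by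
    obtain ⟨H, hH1, hH2⟩ := hL.isExactOn_ball.with_val_at c 0
    exact ⟨H, hH1, hH2⟩
  have hexp : ∀ u ∈ ball c R, F u = F c * Complex.exp (H u) := by
    have hd : ∀ u ∈ ball c R, HasDerivAt (fun v => F v * Complex.exp (-H v)) 0 u := by
      intro u hu
      have h1 := (hF.differentiableAt (isOpen_ball.mem_nhds hu)).hasDerivAt
      have h2 := h1.mul (hH u hu).neg.cexp
      refine h2.congr_deriv ?_
      rw [logDeriv_apply]
      have := hF0 u hu
      field_simp
      ring
    intro u hu
    have := isOpen_ball.is_const_of_deriv_eq_zero (convex_ball c R).isPreconnected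
      (fun v hv => (hd v hv).differentiableAt.differentiableWithinAt)
      (fun v hv => (hd v hv).deriv) hu hc
    simp only [hHc, neg_zero, Complex.exp_zero, mul_one] at this
    rw [← this, mul_assoc, ← Complex.exp_add]
    simp
  have hre : ∀ u ∈ ball c R, (H u).re ≤ A := by
    intro u hu
    have h1 := hbound u hu
    rw [hexp u hu, norm_mul, mul_comm, Complex.norm_exp] at h1
    have := le_of_mul_le_mul_right h1 (norm_pos_iff.2 (hF0 c hc))
    exact Real.exp_le_exp.1 this
  have hHb : ∀ u ∈ closedBall c (R / 2), ‖H u‖ ≤ 2 * A := by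
    intro u hu
    have hsub : ∀ v ∈ ball (0 : ℂ) R, c + v ∈ ball c R := fun v hv => by simpa using hv
    have hu' : ‖u - c‖ ≤ R / 2 := by simpa [dist_eq_norm] using hu
    have := Complex.borelCaratheodory_zero (f := fun v => H (c + v)) (M := A) (R := R)
      (z := u - c) hA
      (fun v hv => by
        have := (hH _ (hsub v hv)).differentiableAt
        exact (this.comp v (by fun_prop)).differentiableWithinAt)
      (fun v hv => hre _ (hsub v hv)) hR (by simpa using by linarith) (by simpa using hHc)
    simp only [add_sub_cancel] at this
    refine this.trans ?_
    rw [div_le_iff₀ (by linarith)]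
    nlinarith [norm_nonneg (u - c)]
  have hLb : ∀ u ∈ closedBall c (R / 4), ‖logDeriv F u‖ ≤ 8 * A / R := by
    intro u hu
    have hu' : dist u c ≤ R / 4 := hu
    have hcb : closedBall u (R / 4) ⊆ closedBall c (R / 2) :=
      closedBall_subset_closedBall' (by linarith)
    have hsub : closedBall c (R / 2) ⊆ ball c R := closedBall_subset_ball (by linarith)
    have := Complex.norm_deriv_le_of_forall_mem_sphere_norm_le (c := u) (R := R / 4) (C := 2 * A)
      (f := H) (by positivity)
      (DifferentiableOn.diffContOnCl_ball (U := ball c R)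
        (fun v hv => (hH v hv).differentiableAt.differentiableWithinAt) (hcb.trans hsub))
      (fun v hv => hHb v (hcb (sphere_subset_closedBall hv)))
    rw [(hH u (hsub (hcb (mem_closedBall_self (by positivity))))).deriv] at this
    refine this.trans (le_of_eq ?_)
    field_simp
    ring
  have hsub8 : ball c (R / 8) ⊆ ball c R := ball_subset_ball (by linarith)
  refine (convex_ball c (R / 8)).norm_image_sub_le_of_norm_deriv_le
    (fun v hv => hL.differentiableAt (isOpen_ball.mem_nhds (hsub8 hv))) (fun v hv => ?_) hw hz
  have hv' : dist v c < R / 8 := hv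
  have hcb : closedBall v (R / 8) ⊆ closedBall c (R / 4) :=
      closedBall_subset_closedBall' (by linarith)
  have := Complex.norm_deriv_le_of_forall_mem_sphere_norm_le (c := v) (R := R / 8)
      (C := 8 * A / R) (f := logDeriv F) (by positivity)
      (DifferentiableOn.diffContOnCl_ball hL
        (hcb.trans (closedBall_subset_ball (by linarith))))
      (fun u hu => hLb u (hcb (sphere_subset_closedBall hu)))
  refine this.trans (le_of_eq ?_)
  field_simp
  ring

/-! ### Dividing out finitely many zeros -/

theorem exists_eq_sub_mul {f : ℂ → ℂ} (hf : Differentiable ℂ f) {c : ℂ} (hc : f c = 0) :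
    ∃ G : ℂ → ℂ, Differentiable ℂ G ∧ ∀ w, f w = (w - c) * G w := by
  refine ⟨dslope f c, ?_, fun w => ?_⟩
  · rw [← differentiableOn_univ] at hf ⊢
    exact (Complex.differentiableOn_dslope univ_mem).2 hf
  · have := sub_smul_dslope f c w
    rw [smul_eq_mul, hc, sub_zero] at this
    exact this.symm

/-- Adding the index `m` to `S` raises the number of indices with value `c` by the order at `c` of
the linear factor `w - z m`, which is `1` or `0`. -/
theorem encard_fiber_insert {ι : Type*} [DecidableEq ι] {S : Finset ι} {m : ι} (hm : m ∉ S)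
    (z : ι → ℂ) (c : ℂ) : {n | n ∈ insert m S ∧ z n = c}.encard =
      analyticOrderAt (fun w => w - z m) c + {n | n ∈ S ∧ z n = c}.encard := by
  by_cases hc : z m = c
  · have h : {n | n ∈ insert m S ∧ z n = c} = insert m {n | n ∈ S ∧ z n = c} := by
      ext n
      simp only [Finset.mem_insert, Set.mem_ofPred_eq, Set.mem_insert_iff]
      constructor
      · rintro ⟨h | h, h'⟩
        · exact Or.inl h
        · exact Or.inr ⟨h, h'⟩
      · rintro (rfl | h)
        · exact ⟨Or.inl rfl, hc⟩
        · exact ⟨Or.inr h.1, h.2⟩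
    rw [h, Set.encard_insert_of_notMem (fun h => hm h.1), ← hc,
      analyticOrderAt_id_sub_const_self, add_comm]
  · rw [analyticOrderAt_id_sub_const_of_ne (Ne.symm hc), zero_add]
    congr 1
    ext n
    simp only [Finset.mem_insert, Set.mem_ofPred_eq]
    constructor
    · rintro ⟨rfl | h, h'⟩
      · exact absurd h' hc
      · exact ⟨h, h'⟩
    · rintro ⟨h, h'⟩
      exact ⟨Or.inr h, h'⟩

/-- An entire function is divisible by every product of linear factors whose zeros it has, with
at least the same multiplicities. -/
theorem exists_eq_prod_mul {ι : Type*} (S : Finset ι) (z : ι → ℂ) {f : ℂ → ℂ}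
    (hf : Differentiable ℂ f)
    (hS : ∀ c, {n | n ∈ S ∧ z n = c}.encard ≤ analyticOrderAt f c) :
    ∃ F : ℂ → ℂ, Differentiable ℂ F ∧ (∀ w, f w = (∏ n ∈ S, (w - z n)) * F w) ∧
      ∀ c, analyticOrderAt f c = {n | n ∈ S ∧ z n = c}.encard + analyticOrderAt F c := by
  classical
  induction S using Finset.induction_on generalizing f with
  | empty => exact ⟨f, hf, by simp, by simp⟩
  | insert m S hm ih =>
    have h1 : analyticOrderAt f (z m) ≠ 0 := by
      intro h0
      have := hS (z m)
      rw [h0, nonpos_iff_eq_zero, Set.encard_eq_zero] at this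
      have hmem : m ∈ {n | n ∈ insert m S ∧ z n = z m} := by simp
      rw [this] at hmem
      exact hmem
    obtain ⟨G, hG, hfG⟩ := exists_eq_sub_mul hf (analyticOrderAt_ne_zero.1 h1).2
    have hord : ∀ c, analyticOrderAt f c =
        analyticOrderAt (fun w => w - z m) c + analyticOrderAt G c := by
      intro c
      rw [show f = (fun w => w - z m) * G from funext hfG]
      exact analyticOrderAt_mul (by fun_prop) (hG.analyticAt c)
    obtain ⟨F, hF, hGF, hordF⟩ := ih hG (by
      intro c
      have h2 := hS c
      rw [hord c, encard_fiber_insert hm] at h2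
      refine (ENat.add_le_add_iff_left ?_).1 h2
      by_cases hc : z m = c
      · simp [← hc]
      · simp [analyticOrderAt_id_sub_const_of_ne (Ne.symm hc)])
    refine ⟨F, hF, fun w => ?_, fun c => ?_⟩
    · rw [hfG, hGF, Finset.prod_insert hm, mul_assoc]
    · rw [hord, hordF, encard_fiber_insert hm, add_assoc]

theorem finite_zeros_inter_closedBall {f : ℂ → ℂ} (hf : Differentiable ℂ f) {c : ℂ} (hc : f c ≠ 0)
    (R : ℝ) : {w ∈ closedBall (0 : ℂ) R | f w = 0}.Finite := by
  by_contra hinf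
  obtain ⟨w, -, hw⟩ := Set.Infinite.exists_accPt_of_subset_isCompact hinf
    (isCompact_closedBall (0 : ℂ) R) (fun w hw => hw.1)
  have hfr : ∃ᶠ u in 𝓝[≠] w, f u = 0 :=
    (accPt_iff_frequently_nhdsNE.1 hw).mono fun u hu => hu.2
  have han : AnalyticOnNhd ℂ f Set.univ := fun u _ => hf.analyticAt u
  exact hc (han.eqOn_zero_of_preconnected_of_frequently_eq_zero isPreconnected_univ
    (Set.mem_univ w) hfr (Set.mem_univ c))

theorem analyticOrderAt_ne_top_of_ne_zero {f : ℂ → ℂ} (hf : Differentiable ℂ f) {c : ℂ}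
    (hc : f c ≠ 0) (w : ℂ) : analyticOrderAt f w ≠ ⊤ := by
  intro h
  have han : AnalyticOnNhd ℂ f Set.univ := fun u _ => hf.analyticAt u
  exact hc (han.eqOn_zero_of_preconnected_of_eventuallyEq_zero isPreconnected_univ
    (Set.mem_univ w) (analyticOrderAt_eq_top.1 h) (Set.mem_univ c))

/-- Only finitely many indices in a list of real zeros belong to zeros in a bounded set. -/
theorem finite_index_abs_le {ι : Type*} {I : Set ι} {z : ι → ℝ} {f : ℂ → ℂ}
    (hf : Differentiable ℂ f) {c : ℂ} (hc : f c ≠ 0)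
    (hz : ∀ x : ℝ, {n | n ∈ I ∧ z n = x}.encard = analyticOrderAt f (x : ℂ)) (R : ℝ) :
    {n | n ∈ I ∧ |z n| ≤ R}.Finite := by
  have hfib : ∀ w : ℂ, {n | n ∈ I ∧ (z n : ℂ) = w}.Finite := by
    intro w
    by_cases hw : ∃ x : ℝ, (x : ℂ) = w
    · obtain ⟨x, rfl⟩ := hw
      rw [← Set.encard_ne_top_iff]
      simp only [Complex.ofReal_inj]
      rw [hz x]
      exact analyticOrderAt_ne_top_of_ne_zero hf hc _
    · convert Set.finite_empty
      ext n
      simp only [Set.mem_ofPred_eq, Set.mem_empty_iff_false, iff_false]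
      exact fun h => hw ⟨z n, h.2⟩
  refine ((finite_zeros_inter_closedBall hf hc R).biUnion fun w _ => hfib w).subset ?_
  rintro n ⟨hn, hR⟩
  refine Set.mem_biUnion (x := (z n : ℂ)) ⟨by simpa using hR, ?_⟩ ⟨hn, rfl⟩
  have : analyticOrderAt f (z n : ℂ) ≠ 0 := by
    rw [← hz]
    exact Set.encard_ne_zero.2 ⟨n, hn, rfl⟩
  exact (analyticOrderAt_ne_zero.1 this).2

/-- Dividing `f` by the linear factors of its zeros in `[-R, R]` leaves an entire function without
zeros in the disk of radius `R` about `i`. The centre `i` is used because it is never a zero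
of `f`. -/
theorem exists_zeroFree_factor {ι : Type*} {I : Set ι} {z : ι → ℝ} {f : ℂ → ℂ}
    (hf : Differentiable ℂ f) (hne : f Complex.I ≠ 0) (hzeros : ∀ w : ℂ, f w = 0 → w.im = 0)
    (hz : ∀ x : ℝ, {n | n ∈ I ∧ z n = x}.encard = analyticOrderAt f (x : ℂ)) {R : ℝ}
    (hfin : {n | n ∈ I ∧ |z n| ≤ R}.Finite) :
    ∃ F : ℂ → ℂ, Differentiable ℂ F ∧
      (∀ w, f w = (∏ n ∈ hfin.toFinset, (w - z n)) * F w) ∧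
      ∀ w ∈ ball Complex.I R, F w ≠ 0 := by
  obtain ⟨F, hF, hfF, hord⟩ := exists_eq_prod_mul hfin.toFinset (fun n => (z n : ℂ)) hf (by
    intro c
    by_cases hc : ∃ x : ℝ, (x : ℂ) = c
    · obtain ⟨x, rfl⟩ := hc
      rw [← hz x]
      refine Set.encard_le_encard ?_
      rintro n ⟨h1, h2⟩
      rw [Set.Finite.mem_toFinset] at h1
      exact ⟨h1.1, by exact_mod_cast h2⟩
    · refine le_of_eq_of_le (Set.encard_eq_zero.2 ?_) zero_le
      ext n
      simp only [Set.mem_ofPred_eq, Set.mem_empty_iff_false, iff_false]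
      exact fun h => hc ⟨z n, h.2⟩)
  refine ⟨F, hF, hfF, fun w hw h0 => ?_⟩
  have hfw : f w = 0 := by rw [hfF, h0, mul_zero]
  obtain ⟨x, rfl⟩ : ∃ x : ℝ, (x : ℂ) = w := ⟨w.re, Complex.ext (by simp) (by simp [hzeros w hfw])⟩
  have hxR : |x| ≤ R := by
    rw [mem_ball, dist_eq_norm] at hw
    have := Complex.abs_re_le_norm ((x : ℂ) - Complex.I)
    simp only [Complex.sub_re, Complex.ofReal_re, Complex.I_re, sub_zero] at this
    linarith
  -- All indices with `z n = x` are used in the product, whose order at `x` is thus that of `f`.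
  have hsub : {n | n ∈ I ∧ z n = x} = {n | n ∈ hfin.toFinset ∧ (z n : ℂ) = x} := by
    ext n
    simp only [Set.mem_ofPred_eq, Set.Finite.mem_toFinset, Complex.ofReal_inj]
    constructor
    · rintro ⟨h, rfl⟩
      exact ⟨⟨h, hxR⟩, rfl⟩
    · rintro ⟨h, h'⟩
      exact ⟨h.1, h'⟩
  have h1 : analyticOrderAt f (x : ℂ) = analyticOrderAt f (x : ℂ) + analyticOrderAt F (x : ℂ) := by
    conv_lhs => rw [hord, ← hsub, hz]
  have h2 := analyticOrderAt_ne_top_of_ne_zero hf hne (x : ℂ)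
  have h3 : analyticOrderAt F (x : ℂ) = 0 := by
    have h4 : analyticOrderAt f (x : ℂ) + analyticOrderAt F (x : ℂ) ≤
        analyticOrderAt f (x : ℂ) + 0 := by rw [← h1, add_zero]
    exact nonpos_iff_eq_zero.1 ((ENat.add_le_add_iff_left h2).1 h4)
  exact (hF.analyticAt _).analyticOrderAt_eq_zero.1 h3 h0

/-! ### The partial fraction expansion of the logarithmic derivative -/

/-- A bound for `|f / f(i)|` on the circle of radius `2 (R + 1)` about `i` passes to the quotient
`F` of `f` by factors with zeros in `[-R, R]`: such a zero is at least as far from the circle as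
from `i`, so that the division does not increase the ratio, and the maximum principle applies. -/
theorem norm_le_exp_of_factor {ι : Type*} {S : Finset ι} {z : ι → ℝ} {f F : ℂ → ℂ} {R A : ℝ}
    (hR : 0 < R) (hF : Differentiable ℂ F) (hfF : ∀ w, f w = (∏ n ∈ S, (w - z n)) * F w)
    (hne : f Complex.I ≠ 0) (hS : ∀ n ∈ S, |z n| ≤ R)
    (hA : ∀ w ∈ sphere Complex.I (2 * (R + 1)), ‖f w‖ ≤ Real.exp A * ‖f Complex.I‖)
    {w : ℂ} (hw : w ∈ ball Complex.I R) : ‖F w‖ ≤ Real.exp A * ‖F Complex.I‖ := by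
  refine Complex.norm_le_of_forall_mem_frontier_norm_le (U := ball Complex.I (2 * (R + 1)))
    isBounded_ball hF.diffContOnCl (fun u hu => ?_)
    (subset_closure (ball_subset_ball (by linarith) hw))
  rw [frontier_ball _ (by positivity)] at hu
  have h1 : ∀ n ∈ S, ‖Complex.I - z n‖ ≤ ‖u - z n‖ := by
    intro n hn
    have h2 : ‖Complex.I - z n‖ ≤ R + 1 := by
      refine (norm_sub_le _ _).trans ?_
      rw [Complex.norm_I, Complex.norm_real, Real.norm_eq_abs]
      linarith [hS n hn]
    have h3 : ‖u - Complex.I‖ = 2 * (R + 1) := by rwa [mem_sphere, dist_eq_norm] at hu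
    have h4 := norm_sub_le_norm_sub_add_norm_sub u (z n : ℂ) Complex.I
    rw [norm_sub_rev (z n : ℂ)] at h4
    linarith
  have hprod : ∏ n ∈ S, ‖Complex.I - z n‖ ≤ ∏ n ∈ S, ‖u - z n‖ :=
    Finset.prod_le_prod (fun _ _ => norm_nonneg _) h1
  have hu1 := hA u hu
  rw [hfF u, hfF Complex.I, norm_mul, norm_mul, norm_prod, norm_prod] at hu1
  have hpos : 0 < ∏ n ∈ S, ‖Complex.I - z n‖ := by
    rw [← norm_prod, norm_pos_iff]
    intro h0
    exact hne (by rw [hfF, h0, zero_mul])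
  refine le_of_mul_le_mul_left ?_ hpos
  calc (∏ n ∈ S, ‖Complex.I - z n‖) * ‖F u‖ ≤ (∏ n ∈ S, ‖u - z n‖) * ‖F u‖ := by gcongr
    _ ≤ _ := hu1
    _ = _ := by ring

theorem logDeriv_eq_sum_add {ι : Type*} {S : Finset ι} {z : ι → ℝ} {f F : ℂ → ℂ}
    (hF : Differentiable ℂ F) (hfF : ∀ w, f w = (∏ n ∈ S, (w - z n)) * F w)
    {w : ℂ} (hw : f w ≠ 0) :
    logDeriv f w = (∑ n ∈ S, 1 / (w - z n)) + logDeriv F w := by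
  have h := hw
  rw [hfF] at h
  have hS : ∀ n ∈ S, w - z n ≠ 0 := Finset.prod_ne_zero_iff.1 (left_ne_zero_of_mul h)
  rw [show f = fun w : ℂ => (∏ n ∈ S, (w - (z n : ℂ))) * F w from funext hfF,
    logDeriv_mul w (left_ne_zero_of_mul h) (right_ne_zero_of_mul h)
      (by fun_prop) hF.differentiableAt, logDeriv_prod hS
      (fun n _ => by fun_prop)]
  congr 1
  refine Finset.sum_congr rfl fun n _ => ?_
  rw [logDeriv_apply]
  simp

/-- Partial fractions for an entire function with real zeros and growth `exp (|w| ^ κ)`, `κ < 2`: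
the difference of two values of `f' / f` is the limit, under symmetric cutoffs, of the sums of
`1 / (w₁ - zₙ) - 1 / (w₂ - zₙ)`. The error at cutoff `R` is an increment of `F' / F`, with `F` the
quotient of `f` by the linear factors in use, and is `O(R ^ (κ - 2))`. No canonical product and no
convergence exponent is needed. -/
theorem tendsto_sum_sub_logDeriv {ι : Type*} {I : Set ι} {z : ι → ℝ} {f : ℂ → ℂ} {κ : ℝ}
    (hf : Differentiable ℂ f) (hne : f Complex.I ≠ 0) (hzeros : ∀ w : ℂ, f w = 0 → w.im = 0)
    (hz : ∀ x : ℝ, {n | n ∈ I ∧ z n = x}.encard = analyticOrderAt f (x : ℂ))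
    (hκ0 : 0 < κ) (hκ2 : κ < 2)
    (hgrowth : ∀ᶠ w in Bornology.cobounded ℂ, ‖f w‖ ≤ Real.exp (‖w‖ ^ κ))
    (hfin : ∀ R : ℝ, {n | n ∈ I ∧ |z n| ≤ R}.Finite) {w₁ w₂ : ℂ} (h₁ : f w₁ ≠ 0) (h₂ : f w₂ ≠ 0) :
    Tendsto (fun R : ℝ => ∑ n ∈ (hfin R).toFinset, (1 / (w₁ - z n) - 1 / (w₂ - z n))) atTop
      (𝓝 (logDeriv f w₁ - logDeriv f w₂)) := by
  obtain ⟨ρ, hρ⟩ : ∃ ρ : ℝ, ∀ w : ℂ, ρ ≤ ‖w‖ → ‖f w‖ ≤ Real.exp (‖w‖ ^ κ) := by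
    rw [← comap_norm_atTop, eventually_comap, eventually_atTop] at hgrowth
    obtain ⟨ρ, hρ⟩ := hgrowth
    exact ⟨ρ, fun w hw => hρ _ hw w rfl⟩
  set A : ℝ → ℝ := fun R => (2 * R + 3) ^ κ + (|Real.log ‖f Complex.I‖| + 1) with hAdef
  have hlim : Tendsto (fun R : ℝ => 64 * A R / R ^ 2 * ‖w₁ - w₂‖) atTop (𝓝 0) := by
    have h1 : Tendsto (fun R : ℝ => 64 * (5 ^ κ * R ^ (-(2 - κ)) +
        (|Real.log ‖f Complex.I‖| + 1) * R ^ (-(2 : ℝ))) * ‖w₁ - w₂‖) atTop (𝓝 0) := by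
      have := ((((tendsto_rpow_neg_atTop (y := 2 - κ) (by linarith)).const_mul (5 ^ κ)).add
        ((tendsto_rpow_neg_atTop (y := 2) (by norm_num)).const_mul
          (|Real.log ‖f Complex.I‖| + 1))).const_mul 64).mul_const ‖w₁ - w₂‖
      simpa using this
    refine squeeze_zero' ?_ ?_ h1
    · filter_upwards [eventually_ge_atTop 1] with R hR
      have : 0 ≤ A R := by positivity
      positivity
    · filter_upwards [eventually_ge_atTop 1] with R hR
      have hR0 : 0 < R := by linarith
      have h2 : (2 * R + 3) ^ κ ≤ 5 ^ κ * R ^ κ := by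
        rw [← Real.mul_rpow (by norm_num) hR0.le]
        exact Real.rpow_le_rpow (by positivity) (by linarith) hκ0.le
      rw [mul_div_assoc]
      gcongr
      have h3 : R ^ (-(2 - κ)) = R ^ κ / R ^ 2 := by
        rw [neg_sub, Real.rpow_sub hR0]
        norm_num
      have h4 : R ^ (-(2 : ℝ)) = 1 / R ^ 2 := by
        rw [Real.rpow_neg hR0.le]
        norm_num
      rw [h3, h4, hAdef]
      simp only [add_div]
      rw [mul_one_div, add_div, ← mul_div_assoc]
      gcongr
  have hmain : ∀ᶠ R in atTop, ‖(∑ n ∈ (hfin R).toFinset, (1 / (w₁ - z n) - 1 / (w₂ - z n))) -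
      (logDeriv f w₁ - logDeriv f w₂)‖ ≤ 64 * A R / R ^ 2 * ‖w₁ - w₂‖ := by
    filter_upwards [eventually_ge_atTop 1, eventually_ge_atTop ρ,
      eventually_gt_atTop (8 * dist w₁ Complex.I),
      eventually_gt_atTop (8 * dist w₂ Complex.I)] with R hR1 hRρ hRw₁ hRw₂
    have hR0 : 0 < R := by linarith
    obtain ⟨F, hF, hfF, hF0⟩ := exists_zeroFree_factor hf hne hzeros hz (hfin R)
    have hA : ∀ w ∈ sphere Complex.I (2 * (R + 1)),
        ‖f w‖ ≤ Real.exp (A R) * ‖f Complex.I‖ := by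
      intro w hw
      rw [mem_sphere, dist_eq_norm] at hw
      have hw1 := norm_sub_le w Complex.I
      have hw2 := norm_sub_norm_le w Complex.I
      rw [Complex.norm_I] at hw1 hw2
      rw [hw] at hw1 hw2
      refine (hρ w (by linarith)).trans ?_
      have h5 : ‖f Complex.I‖ = Real.exp (Real.log ‖f Complex.I‖) :=
        (Real.exp_log (norm_pos_iff.2 hne)).symm
      rw [h5, ← Real.exp_add, Real.exp_le_exp]
      have h6 : ‖w‖ ^ κ ≤ (2 * R + 3) ^ κ :=
        Real.rpow_le_rpow (norm_nonneg _) (by linarith) hκ0.le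
      have h7 := neg_abs_le (Real.log ‖f Complex.I‖)
      simp only [hAdef]
      linarith
    have hApos : 0 < A R := by positivity
    have key := norm_logDeriv_sub_le hR0 hApos hF.differentiableOn hF0
      (fun w hw => norm_le_exp_of_factor hR0 hF hfF hne
        (fun n hn => ((hfin R).mem_toFinset.1 hn).2) hA hw)
      (z := w₁) (w := w₂) (by rw [mem_ball]; linarith) (by rw [mem_ball]; linarith)
    refine le_trans (le_of_eq ?_) key
    rw [logDeriv_eq_sum_add hF hfF h₁, logDeriv_eq_sum_add hF hfF h₂, Finset.sum_sub_distrib,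
      ← norm_neg]
    congr 1
    ring
  rw [tendsto_iff_norm_sub_tendsto_zero]
  exact squeeze_zero' (Eventually.of_forall fun _ => norm_nonneg _) hmain hlim

/-! ### Growth of functions of finite order -/

theorem norm_le_maxModulus {f : ℂ → ℂ} (hf : Continuous f) (w : ℂ) :
    ‖f w‖ ≤ maxModulus f ‖w‖ :=
  le_csSup ((isCompact_sphere (0 : ℂ) ‖w‖).image hf.norm).bddAbove ⟨w, by simp, rfl⟩

theorem eventually_norm_le_exp_rpow {f : ℂ → ℂ} (hf : Continuous f) {κ : ℝ}
    (hord : entireOrder f < (κ : EReal)) :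
    ∀ᶠ w in Bornology.cobounded ℂ, ‖f w‖ ≤ Real.exp (‖w‖ ^ κ) := by
  have h1 := eventually_lt_of_limsup_lt hord
  filter_upwards [tendsto_norm_cobounded_atTop.eventually h1,
    tendsto_norm_cobounded_atTop.eventually_gt_atTop 1] with w hw hw1
  refine (norm_le_maxModulus hf w).trans ?_
  set r := ‖w‖
  set M := maxModulus f r
  rw [EReal.coe_lt_coe_iff, div_lt_iff₀ (Real.log_pos hw1)] at hw
  -- When `M ≤ 0` or `log M ≤ 0` the iterated logarithm is a junk value, but the bound is trivial.
  rcases le_or_gt M 0 with hM | hM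
  · exact hM.trans (Real.exp_pos _).le
  rw [← Real.log_le_iff_le_exp hM]
  rcases le_or_gt (Real.log M) 0 with hL | hL
  · exact hL.trans (by positivity)
  rw [Real.rpow_def_of_pos (by linarith), ← Real.log_le_iff_le_exp hL]
  linarith

/-! ### Real entire functions and their lists of zeros -/

theorem hasDerivAt_re_ofReal {f : ℂ → ℂ} (hf : Differentiable ℂ f) (x : ℝ) :
    HasDerivAt (fun t : ℝ => (f t).re) (deriv f x).re x :=
  hf.differentiableAt.hasDerivAt.real_of_complex

theorem im_deriv_ofReal {f : ℂ → ℂ} (hf : Differentiable ℂ f)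
    (hreal : ∀ x : ℝ, (f (x : ℂ)).im = 0) (x : ℝ) : (deriv f x).im = 0 := by
  have h1 : HasDerivAt (fun t : ℝ => (f t).im) (deriv f x).im x :=
    Complex.imCLM.hasFDerivAt.comp_hasDerivAt x
      (hf.differentiableAt (x := (x : ℂ))).hasDerivAt.comp_ofReal
  simp only [hreal] at h1
  exact h1.unique (hasDerivAt_const x 0)

/-- Rolle's theorem for `exp (a x) f(x)`: between two real zeros of `f` lies a zero of
`f' + a f`. -/
theorem exists_deriv_add_mul_eq_zero {f : ℂ → ℂ} (hf : Differentiable ℂ f)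
    (hreal : ∀ x : ℝ, (f (x : ℂ)).im = 0) (a : ℝ) {x y : ℝ} (hxy : x < y)
    (hx : f x = 0) (hy : f y = 0) :
    ∃ c : ℝ, x < c ∧ c < y ∧ deriv f c + a * f c = 0 := by
  have hd : ∀ t : ℝ, HasDerivAt (fun t : ℝ => Real.exp (a * t) * (f t).re)
      (Real.exp (a * t) * ((deriv f t).re + a * (f t).re)) t := by
    intro t
    have h1 : HasDerivAt (fun t : ℝ => Real.exp (a * t)) (Real.exp (a * t) * a) t := by
      simpa using ((hasDerivAt_id t).const_mul a).exp
    refine (h1.mul (hasDerivAt_re_ofReal hf t)).congr_deriv ?_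
    ring
  obtain ⟨c, hc, hc0⟩ := exists_hasDerivAt_eq_zero hxy
    (fun t _ => (hd t).continuousAt.continuousWithinAt)
    (by simp [hx, hy]) (fun t _ => hd t)
  refine ⟨c, hc.1, hc.2, Complex.ext ?_ ?_⟩
  · have := (mul_eq_zero.1 hc0).resolve_left (Real.exp_pos _).ne'
    simpa using this
  · simp [im_deriv_ofReal hf hreal, hreal]

namespace IsZeroList

variable {f : ℂ → ℂ} {I : Set ℤ} {z : ℤ → ℝ}

theorem apply_eq_zero (hz : IsZeroList f I z) {n : ℤ} (hn : n ∈ I) : f (z n) = 0 := by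
  have : analyticOrderAt f (z n : ℂ) ≠ 0 := by
    rw [← hz.multiplicity]
    exact Set.encard_ne_zero.2 ⟨n, hn, rfl⟩
  exact (analyticOrderAt_ne_zero.1 this).2

theorem exists_index (hz : IsZeroList f I z) (hf : Differentiable ℂ f) {x : ℝ} (hx : f x = 0) :
    ∃ n ∈ I, z n = x := by
  have : analyticOrderAt f (x : ℂ) ≠ 0 := analyticOrderAt_ne_zero.2 ⟨hf.analyticAt _, hx⟩
  rw [← hz.multiplicity] at this
  exact Set.encard_ne_zero.1 this

/-- A value that is listed twice is a multiple zero. -/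
theorem deriv_eq_zero (hz : IsZeroList f I z) (hf : Differentiable ℂ f) {m n : ℤ} (hm : m ∈ I)
    (hn : n ∈ I) (hmn : m ≠ n) (h : z m = z n) : deriv f (z m) = 0 := by
  by_contra hd
  have h1 := (hf.analyticAt (z m : ℂ)).analyticOrderAt_eq_one_of_zero_deriv_ne_zero
    (hz.apply_eq_zero hm) hd
  rw [← hz.multiplicity, Set.encard_eq_one] at h1
  obtain ⟨k, hk⟩ := h1
  have h2 : m ∈ ({k} : Set ℤ) := hk ▸ ⟨hm, rfl⟩
  have h3 : n ∈ ({k} : Set ℤ) := hk ▸ ⟨hn, h.symm⟩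
  exact hmn (h2.trans h3.symm)

/-- A multiple zero is listed at two adjacent indices. -/
theorem exists_succ_eq (hz : IsZeroList f I z) (hf : Differentiable ℂ f) {x : ℝ} (hx : f x = 0)
    (hx' : deriv f x = 0) : ∃ n ∈ I, n + 1 ∈ I ∧ z n = x ∧ z (n + 1) = x := by
  have h1 := (hf.analyticAt (x : ℂ)).analyticOrderAt_deriv_add_one
  simp only [hx, sub_zero] at h1
  have h2 : analyticOrderAt (deriv f) (x : ℂ) ≠ 0 :=
    analyticOrderAt_ne_zero.2 ⟨(hf.analyticAt _).deriv, hx'⟩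
  have h3 : 1 < {n | n ∈ I ∧ z n = x}.encard := by
    rw [hz.multiplicity, ← h1]
    have h4 : (1 : ℕ∞) ≤ analyticOrderAt (deriv f) (x : ℂ) := Order.one_le_iff_ne_zero.2 h2
    calc (1 : ℕ∞) < 1 + 1 := by norm_num
      _ ≤ _ := by gcongr
  obtain ⟨m, n, ⟨hmI, hm⟩, ⟨hnI, hn⟩, hne⟩ := Set.one_lt_encard_iff.1 h3
  wlog hmn : m < n generalizing m n
  · exact this n m hnI hn hne.symm hmI hm (by omega)
  have hI : m + 1 ∈ I := hz.ordConnected.out hmI hnI ⟨by omega, by omega⟩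
  refine ⟨m, hmI, hI, hm, le_antisymm ?_ ?_⟩
  · rw [← hn]
    exact hz.monotoneOn hI hnI (by omega)
  · rw [← hm]
    exact hz.monotoneOn hmI hI (by omega)

end IsZeroList

/-! ### The shifted comparison of partial fraction sums -/

/-- The points of a monotone list with modulus at most `R` form an interval of indices. -/
theorem exists_toFinset_eq_Icc {I : Set ℤ} {z : ℤ → ℝ} (hI : I.OrdConnected)
    (hmono : MonotoneOn z I) {R : ℝ} (hfin : {n | n ∈ I ∧ |z n| ≤ R}.Finite) {k : ℤ} (hk : k ∈ I)
    (hkR : |z k| ≤ R) : ∃ m M, m ≤ k ∧ k ≤ M ∧ hfin.toFinset = Finset.Icc m M := by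
  have hkS : k ∈ hfin.toFinset := hfin.mem_toFinset.2 ⟨hk, hkR⟩
  have hne : hfin.toFinset.Nonempty := ⟨k, hkS⟩
  refine ⟨hfin.toFinset.min' hne, hfin.toFinset.max' hne, Finset.min'_le _ _ hkS,
    Finset.le_max' _ _ hkS, ?_⟩
  ext n
  refine ⟨fun hn => Finset.mem_Icc.2 ⟨Finset.min'_le _ _ hn, Finset.le_max' _ _ hn⟩, fun hn => ?_⟩
  obtain ⟨h1, h2⟩ := hfin.mem_toFinset.1 (Finset.min'_mem _ hne)
  obtain ⟨h3, h4⟩ := hfin.mem_toFinset.1 (Finset.max'_mem _ hne)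
  rw [Finset.mem_Icc] at hn
  have hnI : n ∈ I := hI.out h1 h3 hn
  refine hfin.mem_toFinset.2 ⟨hnI, abs_le.2 ⟨?_, ?_⟩⟩
  · exact (abs_le.1 h2).1.trans (hmono h1 hnI hn.1)
  · exact (hmono hnI h3 hn.2).trans (abs_le.1 h4).2

/-- Pairing `u (n + 1)` with `v n` leaves two boundary terms. -/
theorem sum_Icc_sub_eq_sum_Ico_shift (u v : ℤ → ℝ) {m M : ℤ} (h : m ≤ M) :
    ∑ n ∈ Finset.Icc m M, (u n - v n) =
      ∑ n ∈ Finset.Ico m M, (u (n + 1) - v n) + u m - v M := by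
  induction M, h using Int.leInduction with
  | base => simp
  | succ M hM ih =>
    have h1 : Finset.Icc m (M + 1) = insert (M + 1) (Finset.Icc m M) := by
      ext n; simp only [Finset.mem_Icc, Finset.mem_insert]; omega
    have h2 : Finset.Ico m (M + 1) = insert M (Finset.Ico m M) := by
      ext n; simp only [Finset.mem_Ico, Finset.mem_insert]; omega
    rw [h1, h2, Finset.sum_insert (by simp), Finset.sum_insert (by simp), ih]
    ring

/-- The interval `(q, p)` contains the point `z k` of the list `z` on `I`, and the points with
smaller and larger index lie strictly to the left and right of `[q, p]`. -/
structure IsolatesIndex (I : Set ℤ) (z : ℤ → ℝ) (q p : ℝ) (k : ℤ) : Prop where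
  mem : k ∈ I
  left_lt : q < z k
  lt_right : z k < p
  lt_left : ∀ j ∈ I, j < k → z j < q
  right_lt : ∀ j ∈ I, k < j → p < z j

namespace IsolatesIndex

variable {I : Set ℤ} {z : ℤ → ℝ} {q p : ℝ} {k : ℤ}

theorem lt_right_of_le (h : IsolatesIndex I z q p k) {j : ℤ} (hj : j ∈ I) (hjk : j ≤ k) :
    z j < p := by
  rcases hjk.lt_or_eq with h1 | rfl
  · linarith [h.lt_left j hj h1, h.left_lt, h.lt_right]
  · exact h.lt_right

theorem left_lt_of_le (h : IsolatesIndex I z q p k) {j : ℤ} (hj : j ∈ I) (hjk : k ≤ j) :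
    q < z j := by
  rcases hjk.lt_or_eq with h1 | rfl
  · linarith [h.right_lt j hj h1, h.left_lt, h.lt_right]
  · exact h.left_lt

/-- The points `z n` and `z (n + 1)` lie on the same side of `q` and `p`, respectively. -/
theorem mul_pos (h : IsolatesIndex I z q p k) {n : ℤ} (hn : n ∈ I) (hn' : n + 1 ∈ I) :
    0 < (p - z (n + 1)) * (q - z n) := by
  rcases lt_or_ge n k with h1 | h1
  · exact _root_.mul_pos (sub_pos.2 (h.lt_right_of_le hn' (by omega)))
      (sub_pos.2 (h.lt_left n hn h1))
  · exact mul_pos_of_neg_of_neg (sub_neg.2 (h.right_lt _ hn' (by omega)))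
      (sub_neg.2 (h.left_lt_of_le hn h1))

/-- The sign of a shifted term is that of the difference between the gap `z (n + 1) - z n` and
`p - q`. -/
theorem shifted_term (h : IsolatesIndex I z q p k) {n : ℤ} (hn : n ∈ I) (hn' : n + 1 ∈ I) :
    1 / (p - z (n + 1)) - 1 / (q - z n) =
      (z (n + 1) - z n - (p - q)) / ((p - z (n + 1)) * (q - z n)) := by
  have h1 := (h.mul_pos hn hn').ne'
  rw [div_sub_div _ _ (left_ne_zero_of_mul h1) (right_ne_zero_of_mul h1)]
  congr 1
  ring

/-- For every large cutoff, the symmetric partial sum equals a sum of shifted terms plus two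
boundary terms, and the range of summation reaches beyond any index `j` fixed in advance. -/
theorem eventually_sum_eq (h : IsolatesIndex I z q p k) (hI : I.OrdConnected)
    (hmono : MonotoneOn z I) (hfin : ∀ R : ℝ, {n | n ∈ I ∧ |z n| ≤ R}.Finite) (j : ℤ) :
    ∀ᶠ R in atTop, ∃ m M, m ≤ k ∧ k ≤ M ∧ (hfin R).toFinset = Finset.Icc m M ∧
      (j ∈ I → m ≤ j ∧ j ≤ M) ∧ (j + 1 ∈ I → m ≤ j + 1 ∧ j + 1 ≤ M) ∧
      ∑ n ∈ (hfin R).toFinset, (1 / (p - z n) - 1 / (q - z n)) =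
        ∑ n ∈ Finset.Ico m M, (1 / (p - z (n + 1)) - 1 / (q - z n)) +
          1 / (p - z m) + 1 / (z M - q) := by
  filter_upwards [eventually_ge_atTop |z k|, eventually_ge_atTop |z j|,
    eventually_ge_atTop |z (j + 1)|] with R hRk hRj hRj'
  obtain ⟨m, M, hm, hM, hS⟩ := exists_toFinset_eq_Icc hI hmono (hfin R) h.mem hRk
  refine ⟨m, M, hm, hM, hS, fun hj => ?_, fun hj => ?_, ?_⟩
  · rw [← Finset.mem_Icc, ← hS, (hfin R).mem_toFinset]
    exact ⟨hj, hRj⟩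
  · rw [← Finset.mem_Icc, ← hS, (hfin R).mem_toFinset]
    exact ⟨hj, hRj'⟩
  · rw [hS, sum_Icc_sub_eq_sum_Ico_shift (fun n => 1 / (p - z n)) (fun n => 1 / (q - z n))
      (hm.trans hM), ← neg_sub q (z M), one_div_neg_eq_neg_one_div]
    ring

/-- If no gap is shorter than `p - q`, then all shifted terms and both boundary terms are
nonnegative, while their sums tend to `0`. Hence every shifted term vanishes, that is, every gap
equals `p - q`; and the list has no first or last point, since either would contribute the same
positive boundary term for every large cutoff. -/
theorem eq_univ_and_gap_eq_of_le (h : IsolatesIndex I z q p k) (hI : I.OrdConnected)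
    (hmono : MonotoneOn z I) (hfin : ∀ R : ℝ, {n | n ∈ I ∧ |z n| ≤ R}.Finite)
    (hlim : Tendsto (fun R : ℝ => ∑ n ∈ (hfin R).toFinset, (1 / (p - z n) - 1 / (q - z n)))
      atTop (𝓝 0))
    (hgap : ∀ n, n ∈ I → n + 1 ∈ I → p - q ≤ z (n + 1) - z n) :
    I = Set.univ ∧ ∀ n, z (n + 1) - z n = p - q := by
  have hterm : ∀ n, n ∈ I → n + 1 ∈ I → 0 ≤ 1 / (p - z (n + 1)) - 1 / (q - z n) := by
    intro n hn hn'
    rw [h.shifted_term hn hn']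
    exact div_nonneg (by linarith [hgap n hn hn']) (h.mul_pos hn hn').le
  -- Along the cutoffs the sum dominates each of its three nonnegative parts.
  have hev : ∀ j, ∀ᶠ R in atTop, ∃ m M, m ∈ I ∧ M ∈ I ∧
      (j ∈ I → m ≤ j ∧ j ≤ M) ∧
      (j ∈ I → j + 1 ∈ I → 1 / (p - z (j + 1)) - 1 / (q - z j) ≤
        ∑ n ∈ (hfin R).toFinset, (1 / (p - z n) - 1 / (q - z n))) ∧
      1 / (p - z m) ≤ ∑ n ∈ (hfin R).toFinset, (1 / (p - z n) - 1 / (q - z n)) ∧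
      1 / (z M - q) ≤ ∑ n ∈ (hfin R).toFinset, (1 / (p - z n) - 1 / (q - z n)) := by
    intro j
    filter_upwards [h.eventually_sum_eq hI hmono hfin j] with R hR
    obtain ⟨m, M, hm, hM, hS, hj, hj', hsum⟩ := hR
    have hmemI : ∀ n, m ≤ n → n ≤ M → n ∈ I := by
      intro n h1 h2
      have : n ∈ (hfin R).toFinset := by rw [hS]; exact Finset.mem_Icc.2 ⟨h1, h2⟩
      exact ((hfin R).mem_toFinset.1 this).1
    have hmI := hmemI m le_rfl (hm.trans hM)
    have hMI := hmemI M (hm.trans hM) le_rfl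
    have hterm' : ∀ n ∈ Finset.Ico m M, 0 ≤ 1 / (p - z (n + 1)) - 1 / (q - z n) := by
      intro n hn
      rw [Finset.mem_Ico] at hn
      exact hterm n (hmemI n hn.1 hn.2.le) (hmemI _ (by omega) (by omega))
    have h1 := Finset.sum_nonneg hterm'
    have h2 : 0 ≤ 1 / (p - z m) := (one_div_pos.2 (sub_pos.2 (h.lt_right_of_le hmI hm))).le
    have h3 : 0 ≤ 1 / (z M - q) := (one_div_pos.2 (sub_pos.2 (h.left_lt_of_le hMI hM))).le
    refine ⟨m, M, hmI, hMI, hj, fun hjI hjI' => ?_, ?_, ?_⟩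
    · have h4 := Finset.single_le_sum hterm' (Finset.mem_Ico.2
        ⟨(hj hjI).1, Int.lt_iff_add_one_le.2 (hj' hjI').2⟩)
      linarith
    · linarith
    · linarith
  have hdown : ∀ n ∈ I, n - 1 ∈ I := by
    intro n hn
    by_contra hn'
    have hnk : n ≤ k := by
      by_contra hlt
      exact hn' (hI.out h.mem hn ⟨by omega, by omega⟩)
    have hle : 1 / (p - z n) ≤ 0 := by
      refine ge_of_tendsto hlim ?_
      filter_upwards [hev n] with R hR
      obtain ⟨m, M, hm, hM, hj, -, h5, -⟩ := hR
      have hmn : m = n := by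
        by_contra hne
        have := hj hn
        exact hn' (hI.out hm hn ⟨by omega, by omega⟩)
      rwa [hmn] at h5
    exact absurd (one_div_pos.2 (sub_pos.2 (h.lt_right_of_le hn hnk))) (not_lt.2 hle)
  have hup : ∀ n ∈ I, n + 1 ∈ I := by
    intro n hn
    by_contra hn'
    have hnk : k ≤ n := by
      by_contra hlt
      exact hn' (hI.out hn h.mem ⟨by omega, by omega⟩)
    have hle : 1 / (z n - q) ≤ 0 := by
      refine ge_of_tendsto hlim ?_
      filter_upwards [hev n] with R hR
      obtain ⟨m, M, hm, hM, hj, -, -, h5⟩ := hR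
      have hmn : M = n := by
        by_contra hne
        have := hj hn
        exact hn' (hI.out hn hM ⟨by omega, by omega⟩)
      rwa [hmn] at h5
    exact absurd (one_div_pos.2 (sub_pos.2 (h.left_lt_of_le hn hnk))) (not_lt.2 hle)
  have huniv : I = Set.univ := by
    refine Set.eq_univ_of_forall fun n => ?_
    exact Int.inductionOn' (motive := (· ∈ I)) n k h.mem (fun n _ ih => hup n ih)
      (fun n _ ih => hdown n ih)
  refine ⟨huniv, fun n => ?_⟩
  have hn : n ∈ I := huniv ▸ Set.mem_univ n
  have hn' : n + 1 ∈ I := huniv ▸ Set.mem_univ (n + 1)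
  have h6 : 1 / (p - z (n + 1)) - 1 / (q - z n) ≤ 0 := by
    refine ge_of_tendsto hlim ?_
    filter_upwards [hev n] with R hR
    obtain ⟨m, M, -, -, -, h5, -, -⟩ := hR
    exact h5 hn hn'
  have h7 := le_antisymm h6 (hterm n hn hn')
  rw [h.shifted_term hn hn', div_eq_zero_iff] at h7
  linarith [h7.resolve_right (h.mul_pos hn hn').ne']

/-- If the list is infinite in both directions and no gap is longer than `p - q`, then all shifted
terms are nonpositive. The boundary terms tend to `0`, because bounded gaps keep the outermost
listed points near the cutoffs `±R`; so again every shifted term vanishes. -/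
theorem gap_eq_of_ge (h : IsolatesIndex Set.univ z q p k)
    (hmono : MonotoneOn z Set.univ)
    (hfin : ∀ R : ℝ, {n | n ∈ Set.univ ∧ |z n| ≤ R}.Finite)
    (hlim : Tendsto (fun R : ℝ => ∑ n ∈ (hfin R).toFinset, (1 / (p - z n) - 1 / (q - z n)))
      atTop (𝓝 0))
    (hgap : ∀ n, z (n + 1) - z n ≤ p - q) (j : ℤ) : z (j + 1) - z j = p - q := by
  have hterm : ∀ n, 1 / (p - z (n + 1)) - 1 / (q - z n) ≤ 0 := by
    intro n
    rw [h.shifted_term trivial trivial]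
    exact div_nonpos_of_nonpos_of_nonneg (by linarith [hgap n]) (h.mul_pos trivial trivial).le
  have hev : ∀ᶠ R in atTop, ∑ n ∈ (hfin R).toFinset, (1 / (p - z n) - 1 / (q - z n)) ≤
      1 / (p - z (j + 1)) - 1 / (q - z j) + 1 / (R + q) + 1 / (R - p) := by
    filter_upwards [h.eventually_sum_eq Set.ordConnected_univ hmono hfin j,
      eventually_ge_atTop |z k|, eventually_gt_atTop |p|, eventually_gt_atTop |q|]
      with R hR hRk hRp hRq
    obtain ⟨m, M, hm, hM, hS, hj, hj', hsum⟩ := hR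
    have hmem : ∀ n, |z n| ≤ R ↔ m ≤ n ∧ n ≤ M := by
      intro n
      rw [← Finset.mem_Icc, ← hS, (hfin R).mem_toFinset]
      simp
    have h1 : ∑ n ∈ Finset.Ico m M, (1 / (p - z (n + 1)) - 1 / (q - z n)) ≤
        1 / (p - z (j + 1)) - 1 / (q - z j) := by
      have h4 := Finset.single_le_sum (f := fun n => -(1 / (p - z (n + 1)) - 1 / (q - z n)))
        (fun n _ => neg_nonneg.2 (hterm n)) (Finset.mem_Ico.2
        ⟨(hj trivial).1, Int.lt_iff_add_one_le.2 (hj' trivial).2⟩)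
      rw [Finset.sum_neg_distrib] at h4
      linarith
    have hRk' := abs_le.1 hRk
    have hRp' := abs_lt.1 hRp
    have hRq' := abs_lt.1 hRq
    -- The neighbours `m - 1` and `M + 1` lie beyond the cutoff, and the gaps are bounded.
    have h2 : 1 / (p - z m) ≤ 1 / (R + q) := by
      have h5 : ¬ |z (m - 1)| ≤ R := by rw [hmem]; omega
      have h6 : z (m - 1) ≤ z k := hmono trivial trivial (by omega)
      have h7 : z (m - 1) < -R := by
        by_contra h8
        exact h5 (abs_le.2 ⟨not_lt.1 h8, by linarith⟩)
      have h9 := hgap (m - 1)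
      rw [sub_add_cancel] at h9
      exact one_div_le_one_div_of_le (by linarith) (by linarith)
    have h3 : 1 / (z M - q) ≤ 1 / (R - p) := by
      have h5 : ¬ |z (M + 1)| ≤ R := by rw [hmem]; omega
      have h6 : z k ≤ z (M + 1) := hmono trivial trivial (by omega)
      have h7 : R < z (M + 1) := by
        by_contra h8
        exact h5 (abs_le.2 ⟨by linarith, not_lt.1 h8⟩)
      have h9 := hgap M
      exact one_div_le_one_div_of_le (by linarith) (by linarith)
    linarith
  have hlim' : Tendsto (fun R : ℝ => 1 / (p - z (j + 1)) - 1 / (q - z j) + 1 / (R + q) +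
      1 / (R - p)) atTop (𝓝 (1 / (p - z (j + 1)) - 1 / (q - z j) + 0 + 0)) := by
    refine (tendsto_const_nhds.add ?_).add ?_
    · simp only [one_div]
      exact (tendsto_atTop_add_const_right _ q tendsto_id).inv_tendsto_atTop
    · simp only [one_div, sub_eq_add_neg]
      exact (tendsto_atTop_add_const_right _ (-p) tendsto_id).inv_tendsto_atTop
  have h6 := le_of_tendsto_of_tendsto hlim hlim' hev
  rw [add_zero, add_zero] at h6
  have h7 := le_antisymm (hterm j) h6
  rw [h.shifted_term trivial trivial, div_eq_zero_iff] at h7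
  linarith [h7.resolve_right (h.mul_pos trivial trivial).ne']

end IsolatesIndex

/-! ### Consecutive zeros of `f' + a f` that are not zeros of `f` -/

theorem apply_I_ne_zero {f : ℂ → ℂ} (hzeros : ∀ w : ℂ, f w = 0 → w.im = 0) :
    f Complex.I ≠ 0 := fun h => by simpa using hzeros _ h

/-- At a zero of `f' + a f` that is not a zero of `f`, the logarithmic derivative of `f` is `-a`, so
the partial fraction sums for two such points tend to `0`. -/
theorem tendsto_sum_sub_zero {I : Set ℤ} {z : ℤ → ℝ} {f : ℂ → ℂ} {κ a q p : ℝ}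
    (hf : Differentiable ℂ f) (hzeros : ∀ w : ℂ, f w = 0 → w.im = 0)
    (hz : IsZeroList f I z) (hκ0 : 0 < κ) (hκ2 : κ < 2)
    (hgrowth : ∀ᶠ w in Bornology.cobounded ℂ, ‖f w‖ ≤ Real.exp (‖w‖ ^ κ))
    (hfin : ∀ R : ℝ, {n | n ∈ I ∧ |z n| ≤ R}.Finite) (hfq : f q ≠ 0) (hfp : f p ≠ 0)
    (hq : deriv f q + a * f q = 0) (hp : deriv f p + a * f p = 0) :
    Tendsto (fun R : ℝ => ∑ n ∈ (hfin R).toFinset, (1 / (p - z n) - 1 / (q - z n))) atTop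
      (𝓝 0) := by
  have h1 := tendsto_sum_sub_logDeriv hf (apply_I_ne_zero hzeros) hzeros hz.multiplicity hκ0 hκ2
    hgrowth hfin hfp hfq
  have hL : ∀ x : ℝ, f x ≠ 0 → deriv f x + a * f x = 0 → logDeriv f x = -a := by
    intro x hx hx'
    rw [logDeriv_apply, div_eq_iff hx]
    linear_combination hx'
  rw [hL p hfp hp, hL q hfq hq, sub_self] at h1
  have h2 := (Complex.continuous_re.tendsto 0).comp h1
  rw [Complex.zero_re] at h2
  refine h2.congr fun R => ?_
  rw [Function.comp_apply, ← Complex.ofReal_re (∑ n ∈ (hfin R).toFinset, _)]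
  congr 1
  push_cast
  rfl

/-- On an interval free of zeros of `f`, the function `f' / f` is strictly decreasing or constant,
so two consecutive zeros of `f' + a f` must be separated by a zero of `f`. -/
theorem exists_zero_mem_Ioo {I : Set ℤ} {z : ℤ → ℝ} {f : ℂ → ℂ} {κ a q p : ℝ}
    (hf : Differentiable ℂ f) (hzeros : ∀ w : ℂ, f w = 0 → w.im = 0)
    (hz : IsZeroList f I z) (hκ0 : 0 < κ) (hκ2 : κ < 2)
    (hgrowth : ∀ᶠ w in Bornology.cobounded ℂ, ‖f w‖ ≤ Real.exp (‖w‖ ^ κ))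
    (hfq : f q ≠ 0) (hfp : f p ≠ 0)
    (hqp : AreConsecutiveZeros (fun w => deriv f w + (a : ℂ) * f w) q p) :
    ∃ n ∈ I, q < z n ∧ z n < p := by
  by_contra! hno
  obtain ⟨hlt, hq, hp, hcons⟩ := hqp
  have hIne := apply_I_ne_zero hzeros
  have hfin := finite_index_abs_le hf hIne hz.multiplicity
  rcases I.eq_empty_or_nonempty with rfl | ⟨j, hj⟩
  · -- Without zeros the logarithmic derivative is constant, so `f' + a f` vanishes identically.
    have hmid : f ((q + p) / 2 : ℝ) ≠ 0 := by
      intro h0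
      obtain ⟨n, hn, -⟩ := hz.exists_index hf h0
      exact hn
    have h1 := tendsto_sum_sub_logDeriv hf hIne hzeros hz.multiplicity hκ0 hκ2
      hgrowth hfin hmid hfq
    have h2 : logDeriv f ((q + p) / 2 : ℝ) - logDeriv f q = 0 :=
      tendsto_nhds_unique h1 (tendsto_const_nhds.congr fun R => by
        rw [Finset.sum_eq_zero]
        intro n hn
        exact absurd ((hfin R).mem_toFinset.1 hn).1 (Set.notMem_empty n))
    refine hcons ((q + p) / 2) (by linarith) (by linarith) ?_
    rw [sub_eq_zero, logDeriv_apply, logDeriv_apply, div_eq_div_iff hmid hfq] at h2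
    have h3 : (deriv f ((q + p) / 2 : ℝ) + a * f ((q + p) / 2 : ℝ)) * f q = 0 := by
      linear_combination h2 + f ((q + p) / 2 : ℝ) * hq
    exact (mul_eq_zero.1 h3).resolve_right hfq
  · have hlim := tendsto_sum_sub_zero hf hzeros hz hκ0 hκ2 hgrowth hfin hfq hfp hq hp
    -- Each `z n` lies outside `[q, p]`, which makes every term of the sums negative.
    have hside : ∀ n ∈ I, 0 < (p - z n) * (q - z n) := by
      intro n hn
      have hnq : z n ≠ q := fun h => hfq (h ▸ hz.apply_eq_zero hn)
      have hnp : z n ≠ p := fun h => hfp (h ▸ hz.apply_eq_zero hn)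
      rcases lt_or_gt_of_ne hnq with h | h
      · exact mul_pos (by linarith) (by linarith)
      · have := lt_of_le_of_ne (hno n hn h) hnp.symm
        exact mul_pos_of_neg_of_neg (by linarith) (by linarith)
    have hterm : ∀ n ∈ I, 1 / (p - z n) - 1 / (q - z n) < 0 := by
      intro n hn
      have h1 := (hside n hn).ne'
      rw [div_sub_div _ _ (left_ne_zero_of_mul h1) (right_ne_zero_of_mul h1)]
      exact div_neg_of_neg_of_pos (by linarith) (hside n hn)
    refine absurd (le_of_tendsto hlim ?_ : 0 ≤ 1 / (p - z j) - 1 / (q - z j))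
      (not_le.2 (hterm j hj))
    filter_upwards [eventually_ge_atTop |z j|] with R hR
    have hterm' : ∀ n ∈ (hfin R).toFinset, 0 ≤ -(1 / (p - z n) - 1 / (q - z n)) :=
      fun n hn => by linarith [hterm n ((hfin R).mem_toFinset.1 hn).1]
    have h3 := Finset.single_le_sum hterm' ((hfin R).mem_toFinset.2 ⟨hj, hR⟩)
    rw [Finset.sum_neg_distrib] at h3
    linarith

/-- The separating zero of `f` is unique and simple: a second one would, by Rolle's theorem, produce
a zero of `f' + a f` inside `(q, p)`, and a multiple one is itself such a zero. -/
theorem exists_isolatesIndex {I : Set ℤ} {z : ℤ → ℝ} {f : ℂ → ℂ} {κ a q p : ℝ}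
    (hf : Differentiable ℂ f) (hreal : ∀ x : ℝ, (f (x : ℂ)).im = 0)
    (hzeros : ∀ w : ℂ, f w = 0 → w.im = 0)
    (hz : IsZeroList f I z) (hκ0 : 0 < κ) (hκ2 : κ < 2)
    (hgrowth : ∀ᶠ w in Bornology.cobounded ℂ, ‖f w‖ ≤ Real.exp (‖w‖ ^ κ))
    (hfq : f q ≠ 0) (hfp : f p ≠ 0)
    (hqp : AreConsecutiveZeros (fun w => deriv f w + (a : ℂ) * f w) q p) :
    ∃ k, IsolatesIndex I z q p k := by
  obtain ⟨k, hk, hqk, hkp⟩ := exists_zero_mem_Ioo hf hzeros hz hκ0 hκ2 hgrowth hfq hfp hqp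
  obtain ⟨hlt, hq, hp, hcons⟩ := hqp
  have huniq : ∀ j ∈ I, q < z j → z j < p → j = k := by
    intro j hj hqj hjp
    by_contra hjk
    rcases lt_trichotomy (z j) (z k) with h | h | h
    · obtain ⟨c, h1, h2, h3⟩ := exists_deriv_add_mul_eq_zero hf hreal a h (hz.apply_eq_zero hj)
        (hz.apply_eq_zero hk)
      exact hcons c (by linarith) (by linarith) h3
    · refine hcons (z j) hqj hjp ?_
      simp [hz.deriv_eq_zero hf hj hk hjk h, hz.apply_eq_zero hj]
    · obtain ⟨c, h1, h2, h3⟩ := exists_deriv_add_mul_eq_zero hf hreal a h (hz.apply_eq_zero hk)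
        (hz.apply_eq_zero hj)
      exact hcons c (by linarith) (by linarith) h3
  refine ⟨k, hk, hqk, hkp, fun j hj hjk => ?_, fun j hj hjk => ?_⟩
  · have h1 := hz.monotoneOn hj hk hjk.le
    have h2 : z j ≠ q := fun h => hfq (h ▸ hz.apply_eq_zero hj)
    by_contra h3
    exact hjk.ne (huniq j hj (lt_of_le_of_ne (not_lt.1 h3) h2.symm) (by linarith))
  · have h1 := hz.monotoneOn hk hj hjk.le
    have h2 : z j ≠ p := fun h => hfp (h ▸ hz.apply_eq_zero hj)
    by_contra h3
    exact hjk.ne' (huniq j hj (by linarith) (lt_of_le_of_ne (not_lt.1 h3) h2))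

/-! ### Zeros in arithmetic progression -/

theorem eq_add_mul_of_gap_eq {z : ℤ → ℝ} {d : ℝ} (h : ∀ n, z (n + 1) - z n = d) (n : ℤ) :
    z n = z 0 + n * d := by
  induction n with
  | zero => simp
  | succ n ih =>
    have := h n
    push_cast at *
    linarith
  | pred n ih =>
    have := h (-n - 1)
    rw [sub_add_cancel] at this
    push_cast at *
    linarith

theorem norm_sin_le_exp (u : ℂ) : ‖Complex.sin u‖ ≤ Real.exp ‖u‖ := by
  rw [Complex.sin, norm_div, norm_mul, Complex.norm_I, mul_one, Complex.norm_ofNat,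
    div_le_iff₀ (by norm_num)]
  refine (norm_sub_le _ _).trans ?_
  have h1 : ‖Complex.exp (-u * Complex.I)‖ ≤ Real.exp ‖u‖ :=
    (Complex.norm_exp_le_exp_norm _).trans (by simp)
  have h2 : ‖Complex.exp (u * Complex.I)‖ ≤ Real.exp ‖u‖ :=
    (Complex.norm_exp_le_exp_norm _).trans (by simp)
  linarith

theorem isZeroList_sin {z : ℤ → ℝ} {d : ℝ} (hd : 0 < d) (hmono : MonotoneOn z Set.univ)
    (hgap : ∀ n, z n = z 0 + n * d) :
    IsZeroList (fun w : ℂ => Complex.sin (Real.pi / d * (w - z 0))) Set.univ z where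
  ordConnected := Set.ordConnected_univ
  monotoneOn := hmono
  multiplicity c := by
    have hdC : (d : ℂ) ≠ 0 := by exact_mod_cast hd.ne'
    have hpi : (Real.pi : ℂ) ≠ 0 := by exact_mod_cast Real.pi_ne_zero
    have han : AnalyticAt ℂ (fun w : ℂ => Complex.sin (Real.pi / d * (w - z 0))) c :=
      Differentiable.analyticAt (by fun_prop) _
    by_cases hc : Complex.sin (Real.pi / d * (c - z 0)) = 0
    · obtain ⟨k, hk⟩ := Complex.sin_eq_zero_iff.1 hc
      have hck : c = z k := by
        have h1 : (c : ℂ) = z 0 + k * d := by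
          field_simp at hk
          linear_combination hk
        rw [hgap k]
        exact_mod_cast h1
      have hset : {n | n ∈ Set.univ ∧ z n = c} = {k} := by
        ext n
        simp only [Set.mem_univ, true_and, Set.mem_ofPred_eq, Set.mem_singleton_iff]
        constructor
        · intro h
          rw [hck, hgap n, hgap k] at h
          have h2 : (n : ℝ) = k := mul_right_cancel₀ hd.ne' (by linarith)
          exact_mod_cast h2
        · rintro rfl
          exact hck.symm
      rw [hset, Set.encard_singleton]
      refine (han.analyticOrderAt_eq_one_of_zero_deriv_ne_zero hc ?_).symm
      have hder : HasDerivAt (fun w : ℂ => Complex.sin (Real.pi / d * (w - z 0)))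
          (Complex.cos (Real.pi / d * (c - z 0)) * (Real.pi / d)) (c : ℂ) := by
        have h3 : HasDerivAt (fun w : ℂ => (Real.pi / d : ℂ) * (w - z 0)) (Real.pi / d) c := by
          simpa using ((hasDerivAt_id (c : ℂ)).sub_const (z 0 : ℂ)).const_mul (Real.pi / d : ℂ)
        exact h3.csin
      rw [hder.deriv]
      refine mul_ne_zero (fun h0 => ?_) (div_ne_zero hpi hdC)
      have := Complex.sin_sq_add_cos_sq (Real.pi / d * (c - z 0))
      rw [hc, h0] at this
      norm_num at this
    · rw [han.analyticOrderAt_eq_zero.2 hc, Set.encard_eq_zero]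
      ext n
      simp only [Set.mem_univ, true_and, Set.mem_ofPred_eq, Set.mem_empty_iff_false, iff_false]
      rintro rfl
      refine hc (Complex.sin_eq_zero_iff.2 ⟨n, ?_⟩)
      rw [hgap n]
      push_cast
      field_simp
      ring

theorem im_eq_zero_of_sin_eq_zero {d x₀ : ℝ} (hd : 0 < d) {w : ℂ}
    (hw : Complex.sin (Real.pi / d * (w - x₀)) = 0) : w.im = 0 := by
  have hdC : (d : ℂ) ≠ 0 := by exact_mod_cast hd.ne'
  have hpi : (Real.pi : ℂ) ≠ 0 := by exact_mod_cast Real.pi_ne_zero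
  obtain ⟨k, hk⟩ := Complex.sin_eq_zero_iff.1 hw
  have h1 : w = ((x₀ + k * d : ℝ) : ℂ) := by
    push_cast
    field_simp at hk
    linear_combination hk
  rw [h1, Complex.ofReal_im]

theorem eventually_norm_sin_le_exp_rpow (c b : ℂ) :
    ∀ᶠ w in Bornology.cobounded ℂ,
      ‖Complex.sin (c * (w - b))‖ ≤ Real.exp (‖w‖ ^ (3 / 2 : ℝ)) := by
  filter_upwards [tendsto_norm_cobounded_atTop.eventually_gt_atTop 0,
    tendsto_norm_cobounded_atTop.eventually_ge_atTop ‖b‖,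
    tendsto_norm_cobounded_atTop.eventually_ge_atTop ((2 * ‖c‖) ^ 2)] with w hw0 hwb hwc
  refine (norm_sin_le_exp _).trans (Real.exp_le_exp.2 ?_)
  have h1 : 2 * ‖c‖ ≤ √‖w‖ := Real.le_sqrt_of_sq_le hwc
  have h2 : ‖w‖ ^ (3 / 2 : ℝ) = √‖w‖ * ‖w‖ := by
    rw [show (3 / 2 : ℝ) = 1 / 2 + 1 by norm_num, Real.rpow_add hw0, Real.rpow_one,
      Real.sqrt_eq_rpow]
  rw [h2, norm_mul]
  calc ‖c‖ * ‖w - b‖ ≤ ‖c‖ * (‖w‖ + ‖w‖) := by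
        gcongr
        exact (norm_sub_le _ _).trans (by linarith)
    _ = 2 * ‖c‖ * ‖w‖ := by ring
    _ ≤ _ := by gcongr

/-- If `f' / f - s' / s` is the constant `B` on the upper half-plane, where `s` has no zeros, then
`f = K exp (B w) s` there, and by the identity theorem everywhere. -/
theorem exists_eq_mul_exp_mul {f s : ℂ → ℂ} (hf : Differentiable ℂ f) (hs : Differentiable ℂ s)
    {B : ℂ} (hs0 : ∀ w : ℂ, 0 < w.im → s w ≠ 0)
    (hB : ∀ w : ℂ, 0 < w.im → deriv f w * s w - f w * deriv s w = B * (f w * s w)) :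
    ∃ K : ℂ, ∀ w, f w = K * Complex.exp (B * w) * s w := by
  have hU : IsOpen {w : ℂ | 0 < w.im} := isOpen_lt continuous_const Complex.continuous_im
  have hconv : Convex ℝ {w : ℂ | 0 < w.im} := convex_halfSpace_im_gt 0
  have hI : Complex.I ∈ {w : ℂ | 0 < w.im} := by simp
  have hd : ∀ w ∈ {w : ℂ | 0 < w.im},
      HasDerivAt (fun w => f w * Complex.exp (-(B * w)) / s w) 0 w := by
    intro w hw
    have h1 : HasDerivAt (fun w : ℂ => Complex.exp (-(B * w))) (Complex.exp (-(B * w)) * -B) w := by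
      simpa using ((hasDerivAt_id w).const_mul B).neg.cexp
    refine ((hf.differentiableAt.hasDerivAt.mul h1).div hs.differentiableAt.hasDerivAt
      (hs0 w hw)).congr_deriv ?_
    rw [div_eq_zero_iff]
    left
    simp only [Pi.mul_apply]
    linear_combination Complex.exp (-(B * w)) * hB w hw
  set K := f Complex.I * Complex.exp (-(B * Complex.I)) / s Complex.I with hK
  refine ⟨K, fun w => ?_⟩
  have hon : ∀ w ∈ {w : ℂ | 0 < w.im}, f w = K * Complex.exp (B * w) * s w := by
    intro w hw
    have h2 := hU.is_const_of_deriv_eq_zero hconv.isPreconnected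
      (fun v hv => (hd v hv).differentiableAt.differentiableWithinAt)
      (fun v hv => (hd v hv).deriv) hw hI
    rw [← hK, div_eq_iff (hs0 w hw)] at h2
    calc f w = f w * Complex.exp (-(B * w)) * Complex.exp (B * w) := by
          rw [mul_assoc, ← Complex.exp_add]; simp
      _ = _ := by rw [h2]; ring
  have han1 : AnalyticOnNhd ℂ f Set.univ := fun u _ => hf.analyticAt u
  have han2 : AnalyticOnNhd ℂ (fun w => K * Complex.exp (B * w) * s w) Set.univ :=
    fun u _ => Differentiable.analyticAt (by fun_prop) u
  exact congrFun (han1.eq_of_eventuallyEq han2 (z₀ := Complex.I)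
    (Filter.eventually_of_mem (hU.mem_nhds hI) hon)) w

/-- A real entire function with equally spaced simple real zeros and growth of order less than `2`
is compared with the sine function that has the same zeros. -/
theorem isExpCosine_of_gap_eq {z : ℤ → ℝ} {f : ℂ → ℂ} {q d : ℝ}
    (hf : Differentiable ℂ f) (hreal : ∀ x : ℝ, (f (x : ℂ)).im = 0)
    (hzeros : ∀ w : ℂ, f w = 0 → w.im = 0) (hz : IsZeroList f Set.univ z)
    (hgrowth : ∀ᶠ w in Bornology.cobounded ℂ, ‖f w‖ ≤ Real.exp (‖w‖ ^ (3 / 2 : ℝ)))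
    (hd : 0 < d) (hgap : ∀ n, z (n + 1) - z n = d) (hfq : f q ≠ 0) :
    IsExpCosine f := by
  have hzn := eq_add_mul_of_gap_eq hgap
  set s : ℂ → ℂ := fun w => Complex.sin (Real.pi / d * (w - z 0)) with hsdef
  have hs : Differentiable ℂ s := by fun_prop
  have hzs : IsZeroList s Set.univ z := isZeroList_sin hd hz.monotoneOn hzn
  have hszeros : ∀ w, s w = 0 → w.im = 0 := fun w hw => im_eq_zero_of_sin_eq_zero hd hw
  have hfin := finite_index_abs_le hf (apply_I_ne_zero hzeros) hz.multiplicity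
  have hsq : s q ≠ 0 := by
    intro h0
    obtain ⟨n, hn, hnq⟩ := hzs.exists_index hs h0
    exact hfq (hnq ▸ hz.apply_eq_zero hn)
  -- Both logarithmic derivatives have the same partial fractions, so they differ by a constant.
  have hconst : ∀ w, f w ≠ 0 → s w ≠ 0 →
      logDeriv f w - logDeriv f q = logDeriv s w - logDeriv s q := by
    intro w hfw hsw
    exact tendsto_nhds_unique
      (tendsto_sum_sub_logDeriv hf (apply_I_ne_zero hzeros) hzeros hz.multiplicity (by norm_num)
        (by norm_num) hgrowth hfin hfw hfq)
      (tendsto_sum_sub_logDeriv hs (apply_I_ne_zero hszeros) hszeros hzs.multiplicity (by norm_num)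
        (by norm_num) (eventually_norm_sin_le_exp_rpow _ _) hfin hsw hsq)
  have hsreal : ∀ x : ℝ, s x = (Real.sin (Real.pi / d * (x - z 0)) : ℝ) := by
    intro x
    simp [hsdef]
  -- Both functions are real on the real axis, so the constants are real.
  obtain ⟨B, hB⟩ : ∃ B : ℝ, logDeriv f q - logDeriv s q = B := by
    refine ⟨(logDeriv f q - logDeriv s q).re, Complex.ext rfl ?_⟩
    have h1 : ∀ {g : ℂ → ℂ}, Differentiable ℂ g → (∀ x : ℝ, (g x).im = 0) →
        (logDeriv g q).im = 0 := by
      intro g hg hgr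
      rw [logDeriv_apply, Complex.div_im, im_deriv_ofReal hg hgr, hgr]
      simp
    rw [Complex.sub_im, h1 hf hreal, h1 hs (fun x => by rw [hsreal, Complex.ofReal_im])]
    simp
  obtain ⟨K, hK⟩ := exists_eq_mul_exp_mul hf hs (B := B)
    (fun w hw h0 => hw.ne' (hszeros w h0)) (by
      intro w hw
      have hfw : f w ≠ 0 := fun h0 => hw.ne' (hzeros w h0)
      have hsw : s w ≠ 0 := fun h0 => hw.ne' (hszeros w h0)
      have h2 : logDeriv f w - logDeriv s w = B := by
        rw [← hB]
        linear_combination hconst w hfw hsw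
      rw [← h2, logDeriv_apply, logDeriv_apply]
      field_simp)
  obtain ⟨A, hA⟩ : ∃ A : ℝ, K = A := by
    refine ⟨(f q).re / (Real.exp (B * q) * Real.sin (Real.pi / d * (q - z 0))), ?_⟩
    have h3 := hK q
    have h4 : f q = ((f q).re : ℝ) := Complex.ext (by simp) (by simp [hreal])
    have h5 : Complex.exp (B * q) * s q ≠ 0 := mul_ne_zero (Complex.exp_ne_zero _) hsq
    push_cast
    rw [← h4]
    have h6 := hsreal q
    push_cast at h6
    rw [← h6, eq_div_iff h5, h3]
    ring
  refine ⟨A, B, Real.pi / d, -(Real.pi / d * z 0) - Real.pi / 2, fun w => ?_⟩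
  rw [hK w, hA]
  congr 1
  simp only [hsdef]
  rw [← Complex.cos_sub_pi_div_two]
  congr 1
  push_cast
  ring

/-! ### Endpoints at multiple zeros, and the theorem -/

theorem exists_eq_lt_succ {z : ℤ → ℝ} {x : ℝ} (hmono : Monotone z)
    (hfin : {n | z n = x}.Finite) (hx : ∃ n, z n = x) : ∃ n, z n = x ∧ x < z (n + 1) := by
  by_contra! hno
  obtain ⟨m, hm⟩ := hx
  have hall : ∀ j : ℕ, z (m + j) = x := by
    intro j
    induction j with
    | zero => simpa using hm
    | succ j ih =>
      push_cast
      rw [← add_assoc]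
      exact le_antisymm (hno _ ih) (hm.symm.le.trans (hmono (by omega)))
  exact Set.infinite_of_injective_forall_mem (f := fun j : ℕ => m + (j : ℤ))
    (fun i j hij => by simpa using hij) hall hfin

theorem exists_lt_succ_eq {z : ℤ → ℝ} {x : ℝ} (hmono : Monotone z)
    (hfin : {n | z n = x}.Finite) (hx : ∃ n, z n = x) : ∃ n, z n < x ∧ z (n + 1) = x := by
  by_contra! hno
  obtain ⟨m, hm⟩ := hx
  have hall : ∀ j : ℕ, z (m - j) = x := by
    intro j
    induction j with
    | zero => simpa using hm
    | succ j ih =>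
      by_contra hne
      refine hno (m - (j + 1 : ℕ)) (lt_of_le_of_ne (hm ▸ hmono (by omega)) hne) ?_
      rw [← ih]
      congr 1
      push_cast
      ring
  exact Set.infinite_of_injective_forall_mem (f := fun j : ℕ => m - (j : ℤ))
    (fun i j hij => by simpa using hij) hall hfin

theorem sInf_zeroGaps_nonpos_of_multiple_zero {f : ℂ → ℂ} {I : Set ℤ} {z : ℤ → ℝ}
    (hz : IsZeroList f I z) (hf : Differentiable ℂ f) {x : ℝ} (hx : f x = 0)
    (hx' : deriv f x = 0) : sInf (zeroGaps I z) ≤ 0 := by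
  obtain ⟨n, hn, hn', h1, h2⟩ := hz.exists_succ_eq hf hx hx'
  exact sInf_le ⟨n, hn, hn', by rw [h1, h2, sub_self, EReal.coe_zero]⟩

/-- If an endpoint of `[q, p]` is a zero of `f`, then the other endpoint lies no farther away than
the next distinct zero of `f` on its side, by Rolle's theorem. -/
theorem coe_le_sSup_zeroGaps_of_zero {f : ℂ → ℂ} {z : ℤ → ℝ} {a q p : ℝ}
    (hf : Differentiable ℂ f) (hreal : ∀ x : ℝ, (f (x : ℂ)).im = 0)
    (hz : IsZeroList f Set.univ z) (hfin : ∀ x, {n | z n = x}.Finite)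
    (hqp : AreConsecutiveZeros (fun w => deriv f w + (a : ℂ) * f w) q p)
    (h0 : f q = 0 ∨ f p = 0) : ((p - q : ℝ) : EReal) ≤ sSup (zeroGaps Set.univ z) := by
  obtain ⟨-, -, -, hcons⟩ := hqp
  have hmono : Monotone z := monotoneOn_univ.1 hz.monotoneOn
  suffices h : ∃ n, p - q ≤ z (n + 1) - z n by
    obtain ⟨n, hn⟩ := h
    exact (EReal.coe_le_coe_iff.2 hn).trans (le_sSup ⟨n, trivial, trivial, rfl⟩)
  rcases h0 with h0 | h0
  · obtain ⟨m, -, hm⟩ := hz.exists_index hf h0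
    obtain ⟨n, hn, hlt⟩ := exists_eq_lt_succ hmono (hfin q) ⟨m, hm⟩
    refine ⟨n, ?_⟩
    by_contra hgap
    obtain ⟨c, h1, h2, h3⟩ := exists_deriv_add_mul_eq_zero hf hreal a hlt h0
      (hz.apply_eq_zero (Set.mem_univ (n + 1)))
    exact hcons c h1 (by linarith) h3
  · obtain ⟨m, -, hm⟩ := hz.exists_index hf h0
    obtain ⟨n, hlt, hn⟩ := exists_lt_succ_eq hmono (hfin p) ⟨m, hm⟩
    refine ⟨n, ?_⟩
    by_contra hgap
    obtain ⟨c, h1, h2, h3⟩ := exists_deriv_add_mul_eq_zero hf hreal a hlt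
      (hz.apply_eq_zero (Set.mem_univ n)) h0
    exact hcons c (by linarith) h2 h3

theorem sInf_sSup_zeroGaps_of_gap_eq {z : ℤ → ℝ} {d : ℝ} (hgap : ∀ n, z (n + 1) - z n = d) :
    sInf (zeroGaps Set.univ z) = d ∧ sSup (zeroGaps Set.univ z) = d := by
  have : zeroGaps Set.univ z = {(d : EReal)} := by
    ext e
    simp [zeroGaps, hgap]
  rw [this]
  exact ⟨sInf_singleton, sSup_singleton⟩

theorem theorem2p2 (f : ℂ → ℂ) (hf : Differentiable ℂ f) (hord : entireOrder f = 1)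
    (hreal : ∀ x : ℝ, (f (x : ℂ)).im = 0) (hzeros : ∀ w : ℂ, f w = 0 → w.im = 0)
    (I : Set ℤ) (z : ℤ → ℝ) (hz : IsZeroList f I z)
    (a q p : ℝ) (hqp : AreConsecutiveZeros (fun w => deriv f w + (a : ℂ) * f w) q p) :
    sInf (zeroGaps I z) ≤ ((p - q : ℝ) : EReal) ∧
    (I = Set.univ → ((p - q : ℝ) : EReal) ≤ sSup (zeroGaps I z)) ∧
    (HasSimpleZeros f → ((p - q : ℝ) : EReal) = sInf (zeroGaps I z) →
      ((p - q : ℝ) : EReal) = sSup (zeroGaps I z) ∧ IsExpCosine f) ∧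
    (I = Set.univ → HasSimpleZeros f → ((p - q : ℝ) : EReal) = sSup (zeroGaps I z) →
      ((p - q : ℝ) : EReal) = sInf (zeroGaps I z) ∧ IsExpCosine f) := by
  have hgrowth := eventually_norm_le_exp_rpow hf.continuous (κ := 3 / 2)
    (by rw [hord, ← EReal.coe_one, EReal.coe_lt_coe_iff]; norm_num)
  have hfin := finite_index_abs_le hf (apply_I_ne_zero hzeros) hz.multiplicity
  have hlt := hqp.1
  by_cases h0 : f q = 0 ∨ f p = 0
  · -- An endpoint at a zero of `f` is a multiple zero, which simplicity excludes.
    obtain ⟨x, hx, hx'⟩ : ∃ x : ℝ, f x = 0 ∧ deriv f x = 0 := by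
      rcases h0 with h0 | h0
      · exact ⟨q, h0, by simpa [h0] using hqp.2.1⟩
      · exact ⟨p, h0, by simpa [h0] using hqp.2.2.1⟩
    refine ⟨(sInf_zeroGaps_nonpos_of_multiple_zero hz hf hx hx').trans ?_, ?_,
      fun hs => absurd hx' (hs x hx), fun _ hs => absurd hx' (hs x hx)⟩
    · exact EReal.coe_nonneg.2 (sub_pos.2 hlt).le
    · rintro rfl
      refine coe_le_sSup_zeroGaps_of_zero hf hreal hz (fun x => (hfin |x|).subset ?_) hqp h0
      rintro n rfl
      exact ⟨trivial, le_rfl⟩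
  · obtain ⟨hfq, hfp⟩ := not_or.1 h0
    obtain ⟨k, hk⟩ := exists_isolatesIndex hf hreal hzeros hz (by norm_num) (by norm_num) hgrowth
      hfq hfp hqp
    have hlim := tendsto_sum_sub_zero hf hzeros hz (by norm_num) (by norm_num) hgrowth hfin
      hfq hfp hqp.2.1 hqp.2.2.1
    have hrigid : (∀ n, z (n + 1) - z n = p - q) → I = Set.univ →
        sInf (zeroGaps I z) = ((p - q : ℝ) : EReal) ∧
          sSup (zeroGaps I z) = ((p - q : ℝ) : EReal) ∧ IsExpCosine f := by
      rintro hgap rfl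
      obtain ⟨h1, h2⟩ := sInf_sSup_zeroGaps_of_gap_eq hgap
      exact ⟨h1, h2, isExpCosine_of_gap_eq hf hreal hzeros hz hgrowth (sub_pos.2 hlt) hgap hfq⟩
    have hinf : ((p - q : ℝ) : EReal) ≤ sInf (zeroGaps I z) →
        sInf (zeroGaps I z) = ((p - q : ℝ) : EReal) ∧
          sSup (zeroGaps I z) = ((p - q : ℝ) : EReal) ∧ IsExpCosine f := by
      intro h
      obtain ⟨h1, h2⟩ := hk.eq_univ_and_gap_eq_of_le hz.ordConnected hz.monotoneOn hfin hlim
        (fun n hn hn' => EReal.coe_le_coe_iff.1 (h.trans (sInf_le ⟨n, hn, hn', rfl⟩)))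
      exact hrigid h2 h1
    have hsup : I = Set.univ → sSup (zeroGaps I z) ≤ ((p - q : ℝ) : EReal) →
        sInf (zeroGaps I z) = ((p - q : ℝ) : EReal) ∧
          sSup (zeroGaps I z) = ((p - q : ℝ) : EReal) ∧ IsExpCosine f := by
      intro hI h
      refine hrigid ?_ hI
      subst hI
      exact hk.gap_eq_of_ge hz.monotoneOn hfin hlim
        (fun n => EReal.coe_le_coe_iff.1 (le_trans (le_sSup (s := zeroGaps Set.univ z)
          ⟨n, trivial, trivial, rfl⟩) h))
    refine ⟨?_, fun hI => ?_, fun _ h => ?_, fun hI _ h => ?_⟩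
    · exact (le_total _ _).elim id fun h => (hinf h).1.le
    · exact (le_total _ _).elim id fun h => (hsup hI h).2.1.ge
    · exact ⟨(hinf h.le).2.1.symm, (hinf h.le).2.2⟩
    · exact ⟨(hsup hI h.ge).1.symm, (hsup hI h.ge).2.2⟩
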